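/- Let $F$ be an infinite field of characteristic not $2$. For an even integer $m \geq 2$, let $\mathrm{Sp}_m(F)$ denote the group of symplectic $m \times m$ matrices over $F$ (equivalently, up to isomorphism, the symplectic group of any non-degenerate alternating bilinear form on an $m$-dimensional $F$-vector space). Call an element $i$ of a group an involution if $i^2 = 1$ (so the identity is included), and let $\ell_m(F) \in \mathbb{N} \cup \{+\infty\}$ be the least integer $k \geq 0$ such that every element of $\mathrm{Sp}_m(F)$ is a product of $k$ involutions of $\mathrm{Sp}_m(F)$, with $\ell_m(F) = +\infty$ if no such $k$ exists. Then the sequence $(\ell_{4n+2}(F))_{n \geq 1}$ is non-increasing, and the sequence $(\ell_{4n}(F))_{n \geq 1}$ is non-increasing. -/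

import Mathlib

/-- An element of a group is `k`-reflectional when it is a product of `k` involutions, an
involution being an element of order `1` or `2` (so the identity counts as an involution). -/
def IsReflectional {G : Type*} [Group G] (k : ℕ) (g : G) : Prop :=
  ∃ L : List G, L.length = k ∧ (∀ i ∈ L, i * i = 1) ∧ L.prod = g

/-- The least `k` such that every element of `G` is a product of `k` involutions,
and `⊤` (that is, `+∞`) if there is no such `k`. -/
noncomputable def reflectionalLength (G : Type*) [Group G] : ℕ∞ :=
  ⨅ (k : ℕ) (_ : ∀ g : G, IsReflectional k g), (k : ℕ∞)

/-- `ellDouble F r` is `ℓ_{2r}(F)`: the least `k` such that every element of the group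
`Sp_{2r}(F)` of symplectic `2r × 2r` matrices is a product of `k` involutions of that group.
(Symplectic groups exist in even dimension only, and we index them by half the dimension.) -/
noncomputable def ellDouble (F : Type*) [Field F] (r : ℕ) : ℕ∞ :=
  reflectionalLength (Matrix.symplecticGroup (Fin r) F)

open Module

/-! It suffices to pass from dimension `2r` to `2r + 4` for `r ≥ 2`: if `k` involutions suffice in
dimension `2r`, they suffice four dimensions higher. A nontrivial transvection is never a product of
three involutions (`not_isInvProd_three_transvection`), so `k ≥ 4`.

Let `g` be an isometry in dimension `2r + 4 ≥ 8`. If `g` acts as `±1` on each of two orthogonal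
regular planes, their sum splits off and `g` is an involution on it. Otherwise a dimension count
shows that the skew map `D = g - g⁻¹` has large rank, and `exists_plane` produces an isotropic plane
`L` on which `b (x, g y)` is symmetric and nondegenerate.

Then `U = L ⊕ gL` is regular, and `g` compresses to an isometry `h` of `W = Uᗮ`. Write `h = d a`
with `d` a product of `k - 2` involutions and `a` a product of two. As `F` is infinite, some `μ ≠ 0,
±1` is not an eigenvalue of `a`. Take `c = c₀ ⊕ d⁻¹` on `U ⊕ W`, where `c₀` is a product of two
involutions sending `g l` to `μ l`; since `k - 2 ≥ 2`, `c` is a product of `k - 2` involutions. Now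
`c g` is `μ` on `L` and induces `a` on `Lᗮ / L`, so it is a product of two involutions
(`isInvProd_two_of_scalar_on_isotropic`), and `g = c⁻¹ (c g)`. -/

namespace SymplecticInvolutions

/-! ### Products of isometric involutions, and orthogonal sums -/

variable {F V : Type*} [Field F] [AddCommGroup V] [Module F V]

/-- An endomorphism preserving the bilinear form `b`. -/
def IsIsom (b : LinearMap.BilinForm F V) (g : End F V) : Prop :=
  ∀ x y, b (g x) (g y) = b x y

/-- An involution preserving the bilinear form `b`. -/
def IsInvol (b : LinearMap.BilinForm F V) (i : End F V) : Prop :=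
  i * i = 1 ∧ IsIsom b i

/-- Products of `k` involutions preserving the bilinear form `b`. -/
def IsInvProd (b : LinearMap.BilinForm F V) : ℕ → End F V → Prop
  | 0, g => g = 1
  | k + 1, g => ∃ i h, IsInvol b i ∧ IsInvProd b k h ∧ g = i * h

variable {b : LinearMap.BilinForm F V}

section Basic

lemma IsIsom.one : IsIsom b 1 := fun _ _ => rfl

lemma IsIsom.mul {g h : End F V} (hg : IsIsom b g) (hh : IsIsom b h) : IsIsom b (g * h) :=
  fun x y => (hg _ _).trans (hh x y)

lemma IsInvol.one : IsInvol b 1 := ⟨one_mul 1, IsIsom.one⟩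

lemma IsInvProd.isIsom {k : ℕ} {g : End F V} (h : IsInvProd b k g) : IsIsom b g := by
  induction k generalizing g with
  | zero => rw [show g = 1 from h]; exact IsIsom.one
  | succ k ih => obtain ⟨i, h, hi, hh, rfl⟩ := h; exact hi.2.mul (ih hh)

lemma IsInvol.isInvProd {i : End F V} (hi : IsInvol b i) : IsInvProd b 1 i :=
  ⟨i, 1, hi, rfl, (mul_one i).symm⟩

lemma IsInvProd.succ {k : ℕ} {g : End F V} (h : IsInvProd b k g) : IsInvProd b (k + 1) g :=
  ⟨1, g, IsInvol.one, h, (one_mul g).symm⟩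

lemma IsInvProd.mono {k l : ℕ} (hkl : k ≤ l) {g : End F V} (h : IsInvProd b k g) :
    IsInvProd b l g := by
  induction l, hkl using Nat.le_induction with
  | base => exact h
  | succ l _ ih => exact ih.succ

/-- The length is written `l + k` so that induction on the length `k` of the left factor unfolds by
definition. -/
lemma IsInvProd.mul {k l : ℕ} {g h : End F V} (hg : IsInvProd b k g) (hh : IsInvProd b l h) :
    IsInvProd b (l + k) (g * h) := by
  induction k generalizing g with
  | zero => rw [show g = 1 from hg, one_mul]; exact hh
  | succ k ih =>
    obtain ⟨i, g, hi, hg, rfl⟩ := hg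
    exact ⟨i, g * h, hi, ih hg, mul_assoc _ _ _⟩

lemma IsInvProd.exists_mul {k l : ℕ} {g : End F V} (hg : IsInvProd b (l + k) g) :
    ∃ g₁ g₂, IsInvProd b k g₁ ∧ IsInvProd b l g₂ ∧ g = g₁ * g₂ := by
  induction k generalizing g with
  | zero => exact ⟨1, g, rfl, hg, (one_mul g).symm⟩
  | succ k ih =>
    obtain ⟨i, g, hi, hg, rfl⟩ := hg
    obtain ⟨g₁, g₂, h₁, h₂, rfl⟩ := ih hg
    exact ⟨i * g₁, g₂, ⟨i, g₁, hi, h₁, rfl⟩, h₂, (mul_assoc _ _ _).symm⟩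

/-- Reverse the word. Isometries are plain endomorphisms here, which eases restriction to subspaces,
so inverses have to be exhibited. -/
lemma IsInvProd.exists_inv {k : ℕ} {g : End F V} (hg : IsInvProd b k g) :
    ∃ g', IsInvProd b k g' ∧ g * g' = 1 ∧ g' * g = 1 := by
  induction k generalizing g with
  | zero => exact ⟨1, rfl, by rw [show g = 1 from hg]; simp, by rw [show g = 1 from hg]; simp⟩
  | succ k ih =>
    obtain ⟨i, g, hi, hg, rfl⟩ := hg
    obtain ⟨g', h', h₁, h₂⟩ := ih hg
    refine ⟨g' * i, ?_, ?_, ?_⟩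
    · have := h'.mul hi.isInvProd
      rwa [add_comm] at this
    · rw [mul_assoc, ← mul_assoc g, h₁, one_mul, hi.1]
    · rw [mul_assoc, ← mul_assoc i, hi.1, one_mul, h₂]

/-- Transport of products of involutions along an isometry. -/
lemma IsInvProd.conj {W : Type*} [AddCommGroup W] [Module F W] {c : LinearMap.BilinForm F W}
    (e : V ≃ₗ[F] W) (he : ∀ x y, c (e x) (e y) = b x y) {k : ℕ} {g : End F V}
    (hg : IsInvProd b k g) : IsInvProd c k (e.conj g) := by
  induction k generalizing g with
  | zero => rw [show g = 1 from hg]; exact e.conj_id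
  | succ k ih =>
    obtain ⟨i, g, hi, hg, rfl⟩ := hg
    refine ⟨e.conj i, e.conj g, ⟨?_, fun x y => ?_⟩, ih hg, e.conj_comp g i⟩
    · rw [show e.conj i * e.conj i = e.conj (i * i) from (e.conj_comp i i).symm, hi.1]; exact e.conj_id
    · simp only [LinearEquiv.conj_apply_apply]
      rw [he, hi.2, ← he]; simp

/-- The endomorphism of `V = U ⊕ W` acting as `f` on `U` and as `h` on `W`. -/
noncomputable def directSum {U W : Submodule F V} (hc : IsCompl U W) (f : End F U) (h : End F W) :
    End F V :=
  (U.prodEquivOfIsCompl W hc).conj (f.prodMap h)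

lemma directSum_left {U W : Submodule F V} (hc : IsCompl U W) (f : End F U) (h : End F W) (u : U) :
    directSum hc f h u = f u := by
  simp [directSum, LinearEquiv.conj_apply_apply]

lemma directSum_right {U W : Submodule F V} (hc : IsCompl U W) (f : End F U) (h : End F W)
    (w : W) : directSum hc f h w = h w := by
  simp [directSum, LinearEquiv.conj_apply_apply]

lemma ext_of_isCompl {U W : Submodule F V} (hc : IsCompl U W) {f g : End F V}
    (hU : ∀ u : U, f u = g u) (hW : ∀ w : W, f w = g w) : f = g := by
  ext z
  obtain ⟨u, w, rfl, -⟩ := Submodule.existsUnique_add_of_isCompl hc z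
  simp [hU, hW]

lemma IsInvProd.directSum {U W : Submodule F V} (hc : IsCompl U W)
    (hUW : ∀ u ∈ U, ∀ w ∈ W, b u w = 0) (hWU : ∀ w ∈ W, ∀ u ∈ U, b w u = 0) {k : ℕ}
    {f : End F U} {h : End F W} (hf : IsInvProd (b.restrict U) k f)
    (hh : IsInvProd (b.restrict W) k h) : IsInvProd b k (directSum hc f h) := by
  induction k generalizing f h with
  | zero =>
    rw [show f = 1 from hf, show h = 1 from hh]
    exact ext_of_isCompl hc (fun u => by simp [directSum_left])
      (fun u => by simp [directSum_right])
  | succ k ih =>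
    obtain ⟨i, f, hi, hf, rfl⟩ := hf
    obtain ⟨j, h, hj, hh, rfl⟩ := hh
    refine ⟨SymplecticInvolutions.directSum hc i j, _, ⟨?_, fun x y => ?_⟩, ih hf hh, ?_⟩
    · refine ext_of_isCompl hc (fun u => ?_) (fun u => ?_)
      · have := congrArg (fun t : End F U => (t u : V)) hi.1
        simpa [directSum_left] using this
      · have := congrArg (fun t : End F W => (t u : V)) hj.1
        simpa [directSum_right] using this
    · obtain ⟨u, w, rfl, -⟩ := Submodule.existsUnique_add_of_isCompl hc x
      obtain ⟨u', w', rfl, -⟩ := Submodule.existsUnique_add_of_isCompl hc y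
      have h1 := hi.2 u u'
      have h2 := hj.2 w w'
      simp only [LinearMap.BilinForm.restrict_apply, LinearMap.domRestrict_apply] at h1 h2
      simp only [map_add, directSum_left, directSum_right, LinearMap.add_apply, h1, h2]
      rw [hUW _ (i u).2 _ (j w').2, hWU _ (j w).2 _ (i u').2, hUW _ u.2 _ w'.2, hWU _ w.2 _ u'.2]
    · exact ext_of_isCompl hc (fun u => by simp [directSum_left])
        (fun u => by simp [directSum_right])

/-- An isometry that stabilises both terms of an orthogonal decomposition is a product of `k`
involutions as soon as both restrictions are. -/
lemma isInvProd_of_isCompl {U W : Submodule F V} (hc : IsCompl U W)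
    (hUW : ∀ u ∈ U, ∀ w ∈ W, b u w = 0) (hWU : ∀ w ∈ W, ∀ u ∈ U, b w u = 0) {k : ℕ}
    {g : End F V} (gU : ∀ u ∈ U, g u ∈ U) (gW : ∀ w ∈ W, g w ∈ W)
    (hf : IsInvProd (b.restrict U) k (g.restrict gU))
    (hh : IsInvProd (b.restrict W) k (g.restrict gW)) : IsInvProd b k g := by
  have := hf.directSum hc hUW hWU hh
  rwa [show SymplecticInvolutions.directSum hc (g.restrict gU) (g.restrict gW) = g from
    ext_of_isCompl hc (fun u => by simp [directSum_left]) (fun u => by simp [directSum_right])]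
    at this

end Basic

/-! ### Regular subspaces and orthogonal complements -/

section Orthogonal

lemma eq_zero_of_forall (hn : b.Nondegenerate) {x : V} (h : ∀ y, b x y = 0) : x = 0 := hn.1 x h

/-- Vectors with a nonsingular Gram matrix are linearly independent. -/
lemma linearIndependent_of_gram {ι : Type*} [Fintype ι] {v : ι → V}
    (h : ∀ c : ι → F, (∀ j, ∑ i, c i * b (v i) (v j) = 0) → c = 0) : LinearIndependent F v := by
  rw [Fintype.linearIndependent_iff]
  intro c hc
  refine congrFun (h c fun j => ?_)
  have := congrArg (fun z => b z (v j)) hc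
  simpa using this

/-- Vectors with a nonsingular Gram matrix span a subspace on which the form is nondegenerate. -/
lemma isCompl_orthogonal_of_gram [FiniteDimensional F V] (hb : b.IsAlt) {ι : Type*} [Fintype ι]
    {v : ι → V} (h : ∀ c : ι → F, (∀ j, ∑ i, c i * b (v i) (v j) = 0) → c = 0) :
    IsCompl (Submodule.span F (Set.range v)) (b.orthogonal (Submodule.span F (Set.range v))) := by
  rw [LinearMap.BilinForm.isCompl_orthogonal_iff_disjoint hb.isRefl, Submodule.disjoint_def]
  intro z hz hz'
  obtain ⟨c, rfl⟩ := (Submodule.mem_span_range_iff_exists_fun F).1 hz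
  have : c = 0 := h c fun j => by
    have := hb.isRefl _ _ (hz' (v j) (Submodule.subset_span ⟨j, rfl⟩))
    simpa using this
  simp [this]

lemma restrict_isAlt (hb : b.IsAlt) (W : Submodule F V) : (b.restrict W).IsAlt :=
  fun x => hb x

lemma restrict_nondegenerate [FiniteDimensional F V] (hb : b.IsAlt) {W : Submodule F V}
    (hc : IsCompl W (b.orthogonal W)) : (b.restrict W).Nondegenerate :=
  b.nondegenerate_restrict_of_disjoint_orthogonal hb.isRefl hc.disjoint

lemma isCompl_orthogonal_orthogonal [FiniteDimensional F V] (hb : b.IsAlt) (hn : b.Nondegenerate)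
    {W : Submodule F V} (hc : IsCompl W (b.orthogonal W)) :
    IsCompl (b.orthogonal W) (b.orthogonal (b.orthogonal W)) := by
  rw [LinearMap.BilinForm.orthogonal_orthogonal hn hb.isRefl]
  exact hc.symm

end Orthogonal

/-! ### Symplectic bases, and passage between matrices and isometries -/

section Transfer

lemma gram_pair (hb : b.IsAlt) {x y : V} (hxy : b x y ≠ 0) :
    ∀ c : Fin 2 → F, (∀ j, ∑ i, c i * b (![x, y] i) (![x, y] j) = 0) → c = 0 := by
  intro c h
  have h0 := h 0
  have h1 := h 1
  have hyx : b y x ≠ 0 := fun h => hxy (hb.isRefl _ _ h)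
  simp [Fin.sum_univ_two, hb.self_eq_zero, hxy, hyx] at h0 h1
  ext i
  fin_cases i <;> simp [h0, h1]

lemma exists_symplectic_vectors [FiniteDimensional F V] (r : ℕ) (hb : b.IsAlt) (hn : b.Nondegenerate)
    (hr : finrank F V = 2 * r) :
    ∃ e f : Fin r → V, (∀ i j, b (e i) (e j) = 0) ∧ (∀ i j, b (f i) (f j) = 0) ∧
      ∀ i j, b (e i) (f j) = if i = j then -1 else 0 := by
  induction r generalizing V with
  | zero => exact ⟨fun _ => 0, fun _ => 0, by simp, by simp, fun i => i.elim0⟩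
  | succ r ih =>
    have : Nontrivial V := Module.nontrivial_of_finrank_pos (R := F) (by omega)
    obtain ⟨x, hx⟩ := exists_ne (0 : V)
    obtain ⟨y, hy⟩ : ∃ y, b x y ≠ 0 := by
      by_contra! h
      exact hx (eq_zero_of_forall hn h)
    have hg := gram_pair hb hy
    have hc := isCompl_orthogonal_of_gram hb hg
    have hd := finrank_span_eq_card (linearIndependent_of_gram hg)
    set U := Submodule.span F (Set.range ![x, y]) with hU
    have hdim := Submodule.finrank_add_eq_of_isCompl hc
    obtain ⟨e, f, he, hf, hef⟩ := ih (restrict_isAlt hb (b.orthogonal U))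
      (restrict_nondegenerate hb (isCompl_orthogonal_orthogonal hb hn hc))
      (by simp only [Fintype.card_fin] at hd; omega)
    have hxU : x ∈ U := Submodule.subset_span ⟨0, rfl⟩
    have hyU : y ∈ U := Submodule.subset_span ⟨1, rfl⟩
    have h1 : ∀ z : b.orthogonal U, b x z = 0 := fun z => z.2 x hxU
    have h2 : ∀ z : b.orthogonal U, b y z = 0 := fun z => z.2 y hyU
    have h3 : ∀ z : b.orthogonal U, b z x = 0 := fun z => hb.isRefl _ _ (h1 z)
    have h4 : ∀ z : b.orthogonal U, b z y = 0 := fun z => hb.isRefl _ _ (h2 z)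
    -- The scalar `-(b x y)⁻¹` matches the sign convention of `J`, whose upper right block is `-1`.
    refine ⟨Fin.cons x fun i => e i, Fin.cons (-(b x y)⁻¹ • y) fun i => f i, ?_, ?_, ?_⟩
    · intro i j
      refine Fin.cases ?_ (fun i => ?_) i <;> refine Fin.cases ?_ (fun j => ?_) j <;>
        simp [h1, h3, hb.self_eq_zero]
      exact he i j
    · intro i j
      refine Fin.cases ?_ (fun i => ?_) i <;> refine Fin.cases ?_ (fun j => ?_) j <;>
        simp [h2, h4, hb.self_eq_zero]
      exact hf i j
    · intro i j
      refine Fin.cases ?_ (fun i => ?_) i <;> refine Fin.cases ?_ (fun j => ?_) j <;>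
        simp [h1, h4, hy, Fin.succ_ne_zero, (Fin.succ_ne_zero _).symm]
      exact hef i j

open Matrix in
/-- Existence of a symplectic basis. -/
lemma exists_symplectic_basis [FiniteDimensional F V] (r : ℕ) (hb : b.IsAlt) (hn : b.Nondegenerate)
    (hr : finrank F V = 2 * r) :
    ∃ B : Basis (Fin r ⊕ Fin r) F V, ∀ i j, b (B i) (B j) = J (Fin r) F i j := by
  obtain ⟨e, f, he, hf, hef⟩ := exists_symplectic_vectors r hb hn hr
  have hfe : ∀ i j, b (f i) (e j) = if i = j then 1 else 0 := fun i j => by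
    rw [← hb.neg_eq, hef]; by_cases h : i = j <;> simp [h, eq_comm]
  have hJ : ∀ i j, b (Sum.elim e f i) (Sum.elim e f j) = J (Fin r) F i j := by
    rintro (i | i) (j | j) <;> simp [J, he, hf, hef, hfe, Matrix.one_apply]
    split_ifs <;> simp
  have hli : LinearIndependent F (Sum.elim e f) := by
    refine linearIndependent_of_gram (b := b) fun c hc => ?_
    have : c ᵥ* J (Fin r) F = 0 := by
      ext j
      simpa [hJ, Matrix.vecMul, dotProduct] using hc j
    have h2 := congrArg (fun v => v ᵥ* J (Fin r) F) this
    simpa [Matrix.vecMul_vecMul, J_squared, Matrix.vecMul_neg] using h2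
  refine ⟨Basis.mk hli (hli.span_eq_top_of_card_eq_finrank' (by simp [hr]; ring)).ge, ?_⟩
  simpa using hJ

open Matrix in
lemma isIsom_iff_mem_symplecticGroup {r : ℕ} {B : Basis (Fin r ⊕ Fin r) F V}
    (hB : ∀ i j, b (B i) (B j) = J (Fin r) F i j) (g : End F V) :
    IsIsom b g ↔ LinearMap.toMatrix B B g ∈ symplecticGroup (Fin r) F := by
  rw [SymplecticGroup.mem_iff']
  have hBJ : LinearMap.BilinForm.toMatrix B b = J (Fin r) F := by
    ext i j; rw [LinearMap.BilinForm.toMatrix_apply, hB]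
  have := LinearMap.BilinForm.toMatrix_comp B B b g g
  rw [hBJ] at this
  rw [← this, ← hBJ]
  constructor
  · intro h
    congr 1
    ext x y
    exact h x y
  · intro h x y
    have := (LinearMap.BilinForm.toMatrix B).injective h
    exact LinearMap.congr_fun₂ this x y

open Matrix in
/-- If all symplectic matrices of size `2r` are products of `k` involutions, then all isometries of
symplectic spaces of dimension `2r` are. -/
lemma isInvProd_of_isReflectional [FiniteDimensional F V] {r k : ℕ}
    (h : ∀ g : symplecticGroup (Fin r) F, IsReflectional k g)
    (hb : b.IsAlt) (hn : b.Nondegenerate) (hr : finrank F V = 2 * r) {g : End F V}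
    (hg : IsIsom b g) : IsInvProd b k g := by
  obtain ⟨B, hB⟩ := exists_symplectic_basis r hb hn hr
  obtain ⟨L, rfl, hL, hp⟩ := h ⟨_, (isIsom_iff_mem_symplecticGroup hB g).1 hg⟩
  have key : ∀ L : List (symplecticGroup (Fin r) F), (∀ i ∈ L, i * i = 1) →
      IsInvProd b L.length (toLin B B (L.prod : symplecticGroup (Fin r) F)) := by
    intro L hL
    induction L with
    | nil => simp [IsInvProd]; rfl
    | cons A L ih =>
      refine ⟨toLin B B (A : Matrix _ _ F), _, ⟨?_, ?_⟩,
        ih fun i hi => hL i (List.mem_cons_of_mem _ hi), ?_⟩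
      · have := congrArg Subtype.val
          (hL A List.mem_cons_self)
        simp only [Submonoid.coe_mul, Submonoid.coe_one] at this
        rw [Module.End.mul_eq_comp, ← toLin_mul, this, toLin_one]; rfl
      · rw [isIsom_iff_mem_symplecticGroup hB, LinearMap.toMatrix_toLin]
        exact A.2
      · rw [List.prod_cons, Submonoid.coe_mul, toLin_mul B B B]; rfl
  have := key L hL
  rw [hp] at this
  simpa using this

open Matrix in
/-- A converse of `isInvProd_of_isReflectional`. -/
lemma isReflectional_of_isInvProd {r k : ℕ} {B : Basis (Fin r ⊕ Fin r) F V}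
    (hB : ∀ i j, b (B i) (B j) = J (Fin r) F i j) (g : symplecticGroup (Fin r) F)
    (h : IsInvProd b k (toLin B B (g : Matrix _ _ F))) : IsReflectional k g := by
  induction k generalizing g with
  | zero =>
    refine ⟨[], rfl, by simp, ?_⟩
    have h : toLin B B (g : Matrix _ _ F) = 1 := h
    ext1
    have := congrArg (LinearMap.toMatrix B B) h
    rw [LinearMap.toMatrix_toLin] at this
    simp [this]
  | succ k ih =>
    obtain ⟨i, f, hi, hf, hg⟩ := h
    have hfm := (isIsom_iff_mem_symplecticGroup hB f).1 hf.isIsom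
    have him := (isIsom_iff_mem_symplecticGroup hB i).1 hi.2
    obtain ⟨L, hl, hL, hp⟩ := ih ⟨_, hfm⟩ (by simpa using hf)
    refine ⟨⟨_, him⟩ :: L, by simp [hl], ?_, ?_⟩
    · intro j hj
      rcases List.mem_cons.1 hj with rfl | hj
      · ext1
        have := LinearMap.toMatrix_mul B i i
        rw [hi.1, LinearMap.toMatrix_one] at this
        exact this.symm
      · exact hL j hj
    · ext1
      rw [List.prod_cons, hp, Submonoid.coe_mul]
      have := congrArg (LinearMap.toMatrix B B) hg
      rw [LinearMap.toMatrix_toLin, LinearMap.toMatrix_mul] at this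
      exact this.symm

open Matrix in
/-- The standard symplectic space. -/
lemma exists_standard (F : Type*) [Field F] (r : ℕ) :
    ∃ b : LinearMap.BilinForm F (Fin r ⊕ Fin r → F), b.IsAlt ∧ b.Nondegenerate ∧
      ∀ i j, b (Pi.basisFun F _ i) (Pi.basisFun F _ j) = J (Fin r) F i j := by
  classical
  refine ⟨Matrix.toBilin' (J (Fin r) F), ?_, ?_, fun i j => ?_⟩
  · intro x
    rw [Matrix.toBilin'_apply']
    simp [J, Matrix.fromBlocks_mulVec, dotProduct, Fintype.sum_sum_type, Matrix.neg_mulVec]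
    rw [neg_add_eq_zero]
    exact Finset.sum_congr rfl fun i _ => mul_comm _ _
  · refine LinearMap.BilinForm.nondegenerate_toBilin'_of_det_ne_zero' _ (isUnit_det_J _ _).ne_zero
  · simp

end Transfer

/-! ### Transvections need at least four involutions -/

section LowerBound

/-- The symplectic transvection attached to the vector `v`. -/
def transvection (b : LinearMap.BilinForm F V) (v : V) : End F V :=
  1 + (b v).smulRight v

lemma transvection_apply (v x : V) : transvection b v x = x + b v x • v := rfl

lemma isIsom_transvection (hb : b.IsAlt) (v : V) : IsIsom b (transvection b v) := by
  intro x y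
  simp only [transvection_apply, map_add, map_smul, LinearMap.add_apply, LinearMap.smul_apply,
    smul_eq_mul, hb.self_eq_zero]
  rw [← hb.neg_eq v x]
  ring

/-- An isometric involution is self-adjoint, so `b (x, k x)` equals both itself and its opposite. -/
lemma apply_invol_self (hb : b.IsAlt) (h2 : (2 : F) ≠ 0) {k : End F V} (hk : IsInvol b k) (x : V) :
    b x (k x) = 0 := by
  have h1 : k (k x) = x := LinearMap.congr_fun hk.1 x
  have h3 := hk.2 x (k x)
  rw [h1, ← hb.neg_eq] at h3
  have : 2 * b x (k x) = 0 := by linear_combination -h3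
  exact (mul_eq_zero.1 this).resolve_left h2

/-- On the eigenvectors `x ± i x` of `i`, the hypothesis makes the square of the linear form `b s`
its own opposite; these vectors span the space. -/
lemma eq_zero_of_sq_invol (hn : b.Nondegenerate) (h2 : (2 : F) ≠ 0) {i : End F V}
    (hi : IsInvol b i) {s : V} (h : ∀ x, b s (i x) ^ 2 = -b s x ^ 2) : s = 0 := by
  have hii : ∀ x, i (i x) = x := LinearMap.congr_fun hi.1
  have hz : ∀ a : F, a ^ 2 = -a ^ 2 → a = 0 := fun a ha => by
    have : 2 * a ^ 2 = 0 := by linear_combination ha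
    exact pow_eq_zero_iff two_ne_zero |>.1 ((mul_eq_zero.1 this).resolve_left h2)
  refine eq_zero_of_forall hn fun x => ?_
  have hp : b s (x + i x) = 0 := hz _ (by
    have := h (x + i x)
    rwa [map_add i, hii, add_comm (i x) x] at this)
  have hm : b s (x - i x) = 0 := hz _ (by
    have := h (x - i x)
    rwa [map_sub i, hii, ← neg_sub x (i x), map_neg, neg_sq] at this)
  rw [map_add] at hp
  rw [map_sub] at hm
  have : 2 * b s x = 0 := by linear_combination hp + hm
  exact (mul_eq_zero.1 this).resolve_left h2

/-- A nontrivial transvection is not a product of three involutions. -/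
lemma not_isInvProd_three_transvection (hb : b.IsAlt) (hn : b.Nondegenerate) (h2 : (2 : F) ≠ 0)
    {v : V} (hv : v ≠ 0) : ¬ IsInvProd b 3 (transvection b v) := by
  rintro ⟨k, -, hk, ⟨i, -, hi, ⟨j, -, hj, rfl, rfl⟩, rfl⟩, ht⟩
  have hkk : ∀ x, k (k x) = x := LinearMap.congr_fun hk.1
  have hii : ∀ x, i (i x) = x := LinearMap.congr_fun hi.1
  have hjj : ∀ x, j (j x) = x := LinearMap.congr_fun hj.1
  -- With `t = k i j`, the product `i j = k t` is studied through the quadratic forms `b (x, i j x)`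
  -- and `b (x, (i j)² x)`. They are explicit in the linear forms `b v` and `b (k v)` (`q1`, `q2`),
  -- and `i` changes their sign because it conjugates `i j` to its inverse (`r1`, `r2`).
  have hg : ∀ x, i (j x) = k x + b v x • k v := fun x => by
    have := congrArg k (LinearMap.congr_fun ht x)
    simp only [transvection_apply, map_add, map_smul, Module.End.mul_apply, hkk,
      Module.End.one_apply] at this
    exact this.symm
  have hvu : b (k v) v = 0 := hb.isRefl _ _ (apply_invol_self hb h2 hk v)
  have hkx : ∀ x, b v (k x) = b (k v) x := fun x => by rw [← hk.2, hkk]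
  have q1 : ∀ x, b x (i (j x)) = -(b v x * b (k v) x) := fun x => by
    rw [hg, map_add, map_smul, apply_invol_self hb h2 hk, smul_eq_mul, ← hb.neg_eq (k v) x]
    ring
  have q2 : ∀ x, b x (i (j (i (j x)))) = -(b v x ^ 2 + b (k v) x ^ 2) := fun x => by
    rw [hg (i (j x)), hg x]
    simp only [map_add, map_smul, hkk, hkx, hvu, smul_eq_mul, hb.self_eq_zero]
    rw [← hb.neg_eq (k v) x, ← hb.neg_eq v x]
    ring
  have r1 : ∀ x, b (i x) (i (j (i x))) = -b x (i (j x)) := fun x => by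
    rw [hi.2, ← hj.2 x (j (i x)), hjj, hb.neg_eq, ← hi.2, hii]
  have r2 : ∀ x, b (i x) (i (j (i (j (i x))))) = -b x (i (j (i (j x)))) := fun x => by
    rw [hi.2, ← hj.2, hjj, ← hi.2, hii, ← hj.2, hjj, ← hi.2, hii, hb.neg_eq]
  -- The second form plus or minus twice the first is minus the square of `b (v ± k v)`.
  have s1 : v + k v = 0 := eq_zero_of_sq_invol hn h2 hi fun x => by
    have h1 := r1 x
    have h2 := r2 x
    rw [q1, q1] at h1
    rw [q2, q2] at h2
    simp only [map_add, LinearMap.add_apply]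
    linear_combination -h2 - 2 * h1
  have s2 : v - k v = 0 := eq_zero_of_sq_invol hn h2 hi fun x => by
    have h1 := r1 x
    have h2 := r2 x
    rw [q1, q1] at h1
    rw [q2, q2] at h2
    simp only [map_sub, LinearMap.sub_apply]
    linear_combination -h2 + 2 * h1
  have : (2 : F) • v = 0 := by
    rw [show (2 : F) • v = (v + k v) + (v - k v) by module, s1, s2, add_zero]
  exact hv ((smul_eq_zero.1 this).resolve_left h2)

end LowerBound

/-! ### Isometries annihilated by `(X - μ)(X - μ⁻¹)` -/

section Quadratic

/-- Isometries annihilated by `(X - μ)(X - μ⁻¹)` with `μ ^ 2 ≠ 1` have hyperbolic pairs of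
eigenvectors. -/
lemma exists_eigenvector_pair [Nontrivial V] (hn : b.Nondegenerate) {w : End F V}
    (hw : IsIsom b w) {μ : F} (h0 : μ ≠ 0) (hμ : μ * μ ≠ 1)
    (hq : ∀ z, w (w z) = (μ + μ⁻¹) • w z - z) :
    ∃ e f, w e = μ • e ∧ w f = μ⁻¹ • f ∧ b e f = 1 := by
  have hE : ∀ z, w (w z - μ⁻¹ • z) = μ • (w z - μ⁻¹ • z) := fun z => by
    rw [map_sub, hq, map_smul, smul_sub, smul_smul, mul_inv_cancel₀ h0]; module
  have hE' : ∀ z, w (w z - μ • z) = μ⁻¹ • (w z - μ • z) := fun z => by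
    rw [map_sub, hq, map_smul, smul_sub, smul_smul, inv_mul_cancel₀ h0]; module
  obtain ⟨e, he, hne⟩ : ∃ e, w e = μ • e ∧ e ≠ 0 := by
    by_contra! h
    obtain ⟨x, hx⟩ := exists_ne (0 : V)
    refine hx (eq_zero_of_forall hn fun y => ?_)
    -- Without `μ`-eigenvectors `w` is the scalar `μ⁻¹`, which is an isometry only if `μ² = 1`.
    have key : ∀ z, w z = μ⁻¹ • z := fun z => sub_eq_zero.1 (h _ (hE z))
    have := hw x y
    rw [key, key] at this
    simp only [map_smul, LinearMap.smul_apply, smul_eq_mul] at this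
    by_contra hne
    apply hμ
    have h3 : μ⁻¹ * μ⁻¹ = 1 := mul_right_cancel₀ hne (by linear_combination this)
    field_simp at h3
    linear_combination -h3
  obtain ⟨y, hy⟩ : ∃ y, b e y ≠ 0 := by
    by_contra! h
    exact hne (eq_zero_of_forall hn h)
  have hey : b e (w y) = μ⁻¹ * b e y := by
    rw [← hw e y, he, map_smul, LinearMap.smul_apply, smul_eq_mul, inv_mul_cancel_left₀ h0]
  have hne' : b e (w y - μ • y) ≠ 0 := by
    rw [map_sub, hey, map_smul, smul_eq_mul, ← sub_mul]
    refine mul_ne_zero (fun h => hμ ?_) hy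
    field_simp at h
    linear_combination -h
  refine ⟨e, (b e (w y - μ • y))⁻¹ • (w y - μ • y), he, ?_, ?_⟩
  · rw [map_smul, hE', smul_comm]
  · rw [map_smul, smul_eq_mul, inv_mul_cancel₀ hne']

/-- The isometric involution exchanging the planes of a symplectic basis of a four-dimensional
space inverts every isometry acting on these planes by inverse scalars. -/
lemma isInvProd_two_of_eigenvectors (hb : b.IsAlt) {w : End F V} (hw : IsIsom b w) {μ : F}
    (h0 : μ ≠ 0) {e₁ e₂ f₁ f₂ : V} (he₁ : w e₁ = μ • e₁) (he₂ : w e₂ = μ • e₂)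
    (hf₁ : w f₁ = μ⁻¹ • f₁) (hf₂ : w f₂ = μ⁻¹ • f₂) (h11 : b e₁ f₁ = 1) (h22 : b e₂ f₂ = 1)
    (h12 : b e₁ f₂ = 0) (h21 : b e₂ f₁ = 0) (hee : b e₁ e₂ = 0) (hff : b f₁ f₂ = 0)
    (hspan : ∀ z, ∃ a c d p : F, z = a • e₁ + c • e₂ + d • f₁ + p • f₂) : IsInvProd b 2 w := by
  have g11 : b f₁ e₁ = -1 := by rw [← hb.neg_eq, h11]
  have g22 : b f₂ e₂ = -1 := by rw [← hb.neg_eq, h22]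
  have g12 : b f₂ e₁ = 0 := by rw [← hb.neg_eq, h12, neg_zero]
  have g21 : b f₁ e₂ = 0 := by rw [← hb.neg_eq, h21, neg_zero]
  have gee : b e₂ e₁ = 0 := by rw [← hb.neg_eq, hee, neg_zero]
  have gff : b f₂ f₁ = 0 := by rw [← hb.neg_eq, hff, neg_zero]
  -- This exchanges `e₁` with `f₂` and `e₂` with `-f₁`; the signs make it an isometry. It swaps the
  -- two eigenspaces, so `i w i = w⁻¹` and `i w` is an involution.
  let i : End F V := -(b f₁).smulRight f₂ + (b f₂).smulRight f₁ - (b e₁).smulRight e₂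
    + (b e₂).smulRight e₁
  have hi : ∀ z, i z = -(b f₁ z • f₂) + b f₂ z • f₁ - b e₁ z • e₂ + b e₂ z • e₁ := fun z => rfl
  have ie₁ : i e₁ = f₂ := by simp [hi, g11, g12, gee, hb.self_eq_zero]
  have ie₂ : i e₂ = -f₁ := by simp [hi, g22, g21, hee, hb.self_eq_zero]
  have if₁ : i f₁ = -e₂ := by simp [hi, h11, h21, gff, hb.self_eq_zero]
  have if₂ : i f₂ = e₁ := by simp [hi, h22, h12, hff, hb.self_eq_zero]
  clear_value i
  have hinv : IsInvol b i := by
    constructor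
    · ext z
      obtain ⟨a, c, d, p, rfl⟩ := hspan z
      simp [ie₁, ie₂, if₁, if₂]
    · intro z z'
      obtain ⟨a, c, d, p, rfl⟩ := hspan z
      obtain ⟨a', c', d', p', rfl⟩ := hspan z'
      simp only [map_add, map_smul, map_neg, LinearMap.add_apply, LinearMap.smul_apply,
        LinearMap.neg_apply, smul_eq_mul, ie₁, ie₂, if₁, if₂, h11, h22, h12, h21, hee, hff, g11,
        g22, g12, g21, gee, gff, hb.self_eq_zero]
      ring
  have hii : ∀ z, i (i z) = z := LinearMap.congr_fun hinv.1
  refine ⟨i, i * w, hinv, ⟨i * w, 1, ⟨?_, hinv.2.mul hw⟩, rfl, (mul_one _).symm⟩, ?_⟩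
  · ext z
    obtain ⟨a, c, d, p, rfl⟩ := hspan z
    simp [ie₁, ie₂, if₁, if₂, he₁, he₂, hf₁, hf₂, h0]
  · rw [← mul_assoc, hinv.1, one_mul]

/-- In dimension four, an isometry annihilated by `(X - μ)(X - μ⁻¹)` with `μ ^ 2 ≠ 1` is a product
of two involutions. -/
lemma isInvProd_two_of_quadratic [FiniteDimensional F V] (hb : b.IsAlt) (hn : b.Nondegenerate)
    (hd : finrank F V = 4) {w : End F V} (hw : IsIsom b w) {μ : F} (h0 : μ ≠ 0) (hμ : μ * μ ≠ 1)
    (hq : ∀ z, w (w z) = (μ + μ⁻¹) • w z - z) : IsInvProd b 2 w := by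
  have : Nontrivial V := Module.nontrivial_of_finrank_pos (R := F) (by omega)
  obtain ⟨e₁, f₁, he₁, hf₁, h11⟩ := exists_eigenvector_pair hn hw h0 hμ hq
  have hg := gram_pair hb (x := e₁) (y := f₁) (by rw [h11]; exact one_ne_zero)
  have hc := isCompl_orthogonal_of_gram hb hg
  have hU := finrank_span_eq_card (linearIndependent_of_gram hg)
  have he₁U : e₁ ∈ Submodule.span F (Set.range ![e₁, f₁]) := Submodule.subset_span ⟨0, rfl⟩
  have hf₁U : f₁ ∈ Submodule.span F (Set.range ![e₁, f₁]) := Submodule.subset_span ⟨1, rfl⟩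
  have hmem : ∀ z, b e₁ z = 0 → b f₁ z = 0 →
      z ∈ b.orthogonal (Submodule.span F (Set.range ![e₁, f₁])) := by
    intro z h1 h2 n hn
    obtain ⟨c, rfl⟩ := (Submodule.mem_span_range_iff_exists_fun F).1 hn
    simp [h1, h2]
  generalize Submodule.span F (Set.range ![e₁, f₁]) = U at *
  have hdim := Submodule.finrank_add_eq_of_isCompl hc
  simp only [Fintype.card_fin] at hU
  have hnt : Nontrivial (b.orthogonal U) := Module.nontrivial_of_finrank_pos (R := F) (by omega)
  have hwU : ∀ z ∈ b.orthogonal U, w z ∈ b.orthogonal U := by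
    intro z hz
    have h1 := hw e₁ z
    have h2 := hw f₁ z
    rw [he₁, map_smul, LinearMap.smul_apply, hz e₁ he₁U, smul_eq_mul] at h1
    rw [hf₁, map_smul, LinearMap.smul_apply, hz f₁ hf₁U, smul_eq_mul] at h2
    exact hmem _ ((mul_eq_zero.1 h1).resolve_left h0)
      ((mul_eq_zero.1 h2).resolve_left (inv_ne_zero h0))
  obtain ⟨e₂, f₂, he₂, hf₂, h22⟩ := exists_eigenvector_pair
    (restrict_nondegenerate hb (isCompl_orthogonal_orthogonal hb hn hc))
    (w := w.restrict hwU) (fun x y => hw x y) h0 hμ (fun z => Subtype.ext (hq z))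
  have he₂' : w e₂ = μ • (e₂ : V) := congrArg Subtype.val he₂
  have hf₂' : w f₂ = μ⁻¹ • (f₂ : V) := congrArg Subtype.val hf₂
  have h22' : b e₂ f₂ = 1 := h22
  have h12 : b e₁ f₂ = 0 := f₂.2 e₁ he₁U
  have h21 : b e₂ f₁ = 0 := hb.isRefl _ _ (e₂.2 f₁ hf₁U)
  have hee : b e₁ e₂ = 0 := e₂.2 e₁ he₁U
  have hff : b f₁ f₂ = 0 := f₂.2 f₁ hf₁U
  refine isInvProd_two_of_eigenvectors hb hw h0 he₁ he₂' hf₁ hf₂' h11 h22' h12 h21 hee hff ?_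
  have hli : LinearIndependent F ![e₁, (e₂ : V), f₁, (f₂ : V)] := by
    refine linearIndependent_of_gram (b := b) fun c hc => ?_
    have g11 : b f₁ e₁ = -1 := by rw [← hb.neg_eq, h11]
    have g22 : b f₂ e₂ = -1 := by rw [← hb.neg_eq, h22']
    have g12 : b f₂ e₁ = 0 := by rw [← hb.neg_eq, h12, neg_zero]
    have g21 : b f₁ e₂ = 0 := by rw [← hb.neg_eq, h21, neg_zero]
    have gee : b e₂ e₁ = 0 := by rw [← hb.neg_eq, hee, neg_zero]
    have gff : b f₂ f₁ = 0 := by rw [← hb.neg_eq, hff, neg_zero]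
    have c0 := hc 0
    have c1 := hc 1
    have c2 := hc 2
    have c3 := hc 3
    simp [Fin.sum_univ_four, hb.self_eq_zero, h11, h22', h12, h21, hee, hff, g11, g22, g12, g21,
      gee, gff] at c0 c1 c2 c3
    ext i
    fin_cases i <;> simp [c0, c1, c2, c3]
  have hs := hli.span_eq_top_of_card_eq_finrank' (by simp [hd])
  intro z
  obtain ⟨c, hc⟩ := (Submodule.mem_span_range_iff_exists_fun F).1 (hs ▸ Submodule.mem_top (x := z))
  exact ⟨c 0, c 1, c 2, c 3, by simp [← hc, Fin.sum_univ_four]⟩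

end Quadratic

/-! ### The induction step from an isotropic plane -/

/-- An isometry that acts as a scalar `μ` on an isotropic plane `L` and as a product `a` of two
involutions on `Lᗮ / L` (represented by a complement `W`) is a product of two involutions if `μ` is
not an eigenvalue of `a`. -/
lemma isInvProd_two_of_scalar_on_isotropic [FiniteDimensional F V] (hb : b.IsAlt)
    (hn : b.Nondegenerate) {L W : Submodule F V} (hLL : ∀ l ∈ L, ∀ l' ∈ L, b l l' = 0)
    (hLW : ∀ l ∈ L, ∀ v ∈ W, b l v = 0) (hW : (b.restrict W).Nondegenerate)
    (hdim : finrank F W + 4 = finrank F V)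
    (hL : ∀ z, (∀ l ∈ L, b l z = 0) → ∃ l ∈ L, ∃ v : W, z = l + v)
    {w : End F V} (hw : IsIsom b w) {μ : F} (h0 : μ ≠ 0) (hμ : μ * μ ≠ 1)
    (hwL : ∀ l ∈ L, w l = μ • l) {a : End F W} (ha : IsInvProd (b.restrict W) 2 a)
    (haμ : ∀ v, a v = μ • v → v = 0) (hwW : ∀ v : W, w v - a v ∈ L) : IsInvProd b 2 w := by
  have hWL : ∀ v ∈ W, ∀ l ∈ L, b v l = 0 := fun v hv l hl => hb.isRefl _ _ (hLW l hl v hv)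
  have hinj : Function.Injective (a - μ • (1 : End F W)) := by
    rw [injective_iff_map_eq_zero]
    exact fun v hv => haμ v (sub_eq_zero.1 hv)
  let A := LinearEquiv.ofInjectiveEndo _ hinj
  have hA : ∀ v, A v = a v - μ • v := fun v => rfl
  let φ : W →ₗ[F] V := w ∘ₗ W.subtype - W.subtype ∘ₗ a
  have hφ : ∀ v, φ v = w v - a v := fun v => rfl
  -- `ψ` solves `ψ a - μ ψ = φ`, which is possible because `a - μ` is invertible. Hence `m = id + ψ`
  -- intertwines `a` and `w`, and its image is a `w`-stable copy of `W`.
  let ψ : W →ₗ[F] V := φ ∘ₗ A.symm.toLinearMap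
  have hψL : ∀ v, ψ v ∈ L := fun v => hwW _
  have hψ : ∀ v, ψ (a v) - μ • ψ v = φ v := fun v => by
    rw [← map_smul, ← map_sub, ← hA]
    simp [ψ]
  clear_value ψ A
  let m : W →ₗ[F] V := W.subtype + ψ
  have hm : ∀ v, m v = v + ψ v := fun v => rfl
  have hwm : ∀ v, w (m v) = m (a v) := fun v => by
    rw [hm, hm, map_add, hwL _ (hψL v), sub_eq_iff_eq_add.1 (hψ v), hφ]
    abel
  have hbm : ∀ v v', b (m v) (m v') = b v v' := fun v v' => by
    simp only [hm, map_add, LinearMap.add_apply, hWL _ v.2 _ (hψL v'), hLW _ (hψL v) _ v'.2,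
      hLL _ (hψL v) _ (hψL v'), add_zero]
  clear_value m
  have hker : ∀ v, (∀ v', b (m v) (m v') = 0) → v = 0 := fun v hv =>
    eq_zero_of_forall hW fun v' => (hbm v v').symm.trans (hv v')
  have hmi : Function.Injective m := by
    rw [injective_iff_map_eq_zero]
    exact fun v hv => hker v fun v' => by simp [hv]
  have hc : IsCompl m.range (b.orthogonal m.range) := by
    rw [LinearMap.BilinForm.isCompl_orthogonal_iff_disjoint hb.isRefl, Submodule.disjoint_def]
    rintro _ ⟨v, rfl⟩ hz
    rw [hker v fun v' => hb.isRefl _ _ (hz (m v') ⟨v', rfl⟩), map_zero]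
  have hc' := isCompl_orthogonal_orthogonal hb hn hc
  obtain ⟨a', -, haa', -⟩ := ha.exists_inv
  have gU : ∀ z ∈ m.range, w z ∈ m.range := by
    rintro _ ⟨v, rfl⟩
    exact ⟨a v, (hwm v).symm⟩
  have gU' : ∀ z ∈ b.orthogonal m.range, w z ∈ b.orthogonal m.range := by
    rintro z hz _ ⟨v, rfl⟩
    have : m v = w (m (a' v)) := by
      rw [hwm]; exact congrArg m (LinearMap.congr_fun haa' v).symm
    change b (m v) (w z) = 0
    rw [this, hw]
    exact hz _ ⟨_, rfl⟩
  have hdim' := Submodule.finrank_add_eq_of_isCompl hc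
  rw [LinearMap.finrank_range_of_inj hmi] at hdim'
  refine isInvProd_of_isCompl hc (fun u hu v hv => hv u hu) (fun v hv u hu => hb.isRefl _ _ (hv u hu))
    gU gU' ?_ ?_
  · have := IsInvProd.conj (b := b.restrict W) (c := b.restrict m.range)
      (LinearEquiv.ofInjective m hmi) (fun v v' => hbm v v') ha
    convert this
    ext ⟨_, v, rfl⟩
    have : (LinearEquiv.ofInjective m hmi).symm ⟨m v, v, rfl⟩ = v := by
      rw [LinearEquiv.symm_apply_eq]; rfl
    rw [LinearEquiv.conj_apply_apply, this]
    exact hwm v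
  · refine isInvProd_two_of_quadratic (restrict_isAlt hb _) (restrict_nondegenerate hb hc')
      (by omega) (fun u v => hw u v) h0 hμ ?_
    rintro ⟨z, hz⟩
    -- This vector is orthogonal to `L`, as `w` is `μ` there, and to the image of `m`, which removes
    -- its `W`-component. Applying `w - μ` then kills it, so `w` is annihilated by `(X - μ)(X -
    -- μ⁻¹)` on the four-dimensional complement.
    have key : w z - μ⁻¹ • z ∈ L := by
      obtain ⟨l, hl, v, hlv⟩ := hL (w z - μ⁻¹ • z) fun l hl => by
        rw [map_sub, map_smul, sub_eq_zero, ← hw l z, hwL l hl, map_smul, LinearMap.smul_apply,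
          smul_smul, inv_mul_cancel₀ h0, one_smul]
      have hmem : w z - μ⁻¹ • z ∈ b.orthogonal m.range :=
        sub_mem (gU' z hz) (Submodule.smul_mem _ _ hz)
      have hv : v = 0 := eq_zero_of_forall hW fun v' => hb.isRefl _ _ (by
        have h1 : b (m v') (l + v) = 0 := hlv ▸ hmem (m v') ⟨v', rfl⟩
        rw [hm] at h1
        change b v' v = 0
        simpa only [map_add, LinearMap.add_apply, hWL _ v'.2 _ hl, hLW _ (hψL v') _ v.2,
          hLL _ (hψL v') _ hl, add_zero, zero_add] using h1)
      rw [hlv, hv]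
      simpa using hl
    refine Subtype.ext ?_
    have := hwL _ key
    rw [map_sub, map_smul, smul_sub, smul_smul, mul_inv_cancel₀ h0, sub_eq_iff_eq_add] at this
    change w (w z) = (μ + μ⁻¹) • w z - z
    rw [this]
    module

lemma eq_zero_of_mul_sub_ne_zero {p q s a c : F} (hd : p * s ≠ q ^ 2) (h1 : a * p + c * q = 0)
    (h2 : a * q + c * s = 0) : a = 0 ∧ c = 0 := by
  have hd' : p * s - q ^ 2 ≠ 0 := sub_ne_zero.2 hd
  constructor
  · refine (mul_eq_zero.1 (?_ : (p * s - q ^ 2) * a = 0)).resolve_left hd'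
    linear_combination s * h1 - q * h2
  · refine (mul_eq_zero.1 (?_ : (p * s - q ^ 2) * c = 0)).resolve_left hd'
    linear_combination p * h2 - q * h1

/-- The symplectic map of the four-dimensional space `L ⊕ g L` that sends `g l` to `μ l` and is
annihilated by `(X - μ)(X - μ⁻¹)`. -/
lemma exists_quadratic_extension [FiniteDimensional F V] (hb : b.IsAlt) (hn : b.Nondegenerate)
    (B : Basis (Fin 4) F V) (h01 : b (B 0) (B 1) = 0) (h23 : b (B 2) (B 3) = 0)
    (hs : b (B 0) (B 3) = b (B 1) (B 2)) {μ : F} (h0 : μ ≠ 0) (hμ : μ * μ ≠ 1) :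
    ∃ c : End F V, IsInvProd b 2 c ∧ c (B 2) = μ • B 0 ∧ c (B 3) = μ • B 1 := by
  -- The first two values are forced by the last two and `c² = (μ + μ⁻¹) c - 1`.
  let c : End F V := B.constr F ![(μ + μ⁻¹) • B 0 - μ⁻¹ • B 2, (μ + μ⁻¹) • B 1 - μ⁻¹ • B 3,
    μ • B 0, μ • B 1]
  have c0 : c (B 0) = (μ + μ⁻¹) • B 0 - μ⁻¹ • B 2 := by simp [c]
  have c1 : c (B 1) = (μ + μ⁻¹) • B 1 - μ⁻¹ • B 3 := by simp [c]
  have c2 : c (B 2) = μ • B 0 := by simp [c]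
  have c3 : c (B 3) = μ • B 1 := by simp [c]
  clear_value c
  refine ⟨c, isInvProd_two_of_quadratic hb hn (by simp [finrank_eq_card_basis B]) ?_ h0 hμ ?_,
    c2, c3⟩
  · intro z z'
    have h10 : b (B 1) (B 0) = 0 := hb.isRefl _ _ h01
    have h32 : b (B 3) (B 2) = 0 := hb.isRefl _ _ h23
    have h20 : b (B 2) (B 0) = -b (B 0) (B 2) := (hb.neg_eq _ _).symm
    have h21 : b (B 2) (B 1) = -b (B 1) (B 2) := (hb.neg_eq _ _).symm
    have h30 : b (B 3) (B 0) = -b (B 1) (B 2) := by rw [← hs, hb.neg_eq]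
    have h31 : b (B 3) (B 1) = -b (B 1) (B 3) := (hb.neg_eq _ _).symm
    rw [← B.sum_repr z, ← B.sum_repr z']
    simp only [Fin.sum_univ_four, map_add, map_sub, map_smul, LinearMap.add_apply,
      LinearMap.sub_apply, LinearMap.smul_apply, smul_eq_mul, c0, c1, c2, c3, h01, h10, h23, h32,
      h20, h21, h30, h31, hs, hb.self_eq_zero]
    field_simp
    ring
  · intro z
    rw [← B.sum_repr z]
    simp only [Fin.sum_univ_four, map_add, map_sub, map_smul, c0, c1, c2, c3]
    match_scalars <;> field_simp <;> ring

/-- The induction step for isometries `g` admitting a suitable plane `L`: it is isotropic, the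
form `b (x, g y)` is symmetric and nondegenerate on it. -/
lemma isInvProd_of_plane [Infinite F] [FiniteDimensional F V] (hb : b.IsAlt)
    (hn : b.Nondegenerate) {k : ℕ} (hk : 4 ≤ k)
    (H : ∀ W : Submodule F V, finrank F W + 4 = finrank F V → (b.restrict W).Nondegenerate →
      ∀ h : End F W, IsIsom (b.restrict W) h → IsInvProd (b.restrict W) k h)
    {g : End F V} (hg : IsIsom b g) {x y : V} (hxy : b x y = 0) (hs : b x (g y) = b y (g x))
    (hd : b x (g x) * b y (g y) ≠ b x (g y) ^ 2) : IsInvProd b k g := by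
  -- In `2 × 2` blocks the Gram matrix has zero diagonal and off-diagonal blocks `P`, `-P`, where
  -- `P` is the invertible symmetric matrix of `b (·, g ·)` on the plane.
  have hgram : ∀ c : Fin 4 → F, (∀ j, ∑ i, c i * b (![x, y, g x, g y] i) (![x, y, g x, g y] j) = 0)
      → c = 0 := by
    intro c hc
    have c0 := hc 0
    have c1 := hc 1
    have c2 := hc 2
    have c3 := hc 3
    have hyx : b y x = 0 := hb.isRefl _ _ hxy
    have e1 : b (g x) x = -b x (g x) := (hb.neg_eq _ _).symm
    have e2 : b (g y) y = -b y (g y) := (hb.neg_eq _ _).symm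
    have e3 : b (g x) y = -b x (g y) := by rw [hs, hb.neg_eq]
    have e4 : b (g y) x = -b x (g y) := by rw [hb.neg_eq]
    simp [Fin.sum_univ_four, hb.self_eq_zero, hg x y, hg y x, hxy, hyx, e1, e2, e3, e4, ← hs]
      at c0 c1 c2 c3
    obtain ⟨r0, r1⟩ := eq_zero_of_mul_sub_ne_zero hd c2 c3
    obtain ⟨r2, r3⟩ := eq_zero_of_mul_sub_ne_zero (a := c 2) (c := c 3) hd
      (by linear_combination -c0) (by linear_combination -c1)
    ext i
    fin_cases i <;> simp [r0, r1, r2, r3]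
  have hli := linearIndependent_of_gram hgram
  have hc := isCompl_orthogonal_of_gram hb hgram
  let B := Basis.span hli
  have hB : ∀ i, (B i : V) = ![x, y, g x, g y] i := fun i =>
    congrArg Subtype.val (Basis.span_apply hli i)
  have hspan : ∀ z ∈ Submodule.span F (Set.range ![x, y, g x, g y]), ∃ a₁ a₂ a₃ a₄ : F,
      z = a₁ • x + a₂ • y + a₃ • g x + a₄ • g y := by
    intro z hz
    obtain ⟨c, rfl⟩ := (Submodule.mem_span_range_iff_exists_fun F).1 hz
    exact ⟨c 0, c 1, c 2, c 3, by simp [Fin.sum_univ_four]⟩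
  clear_value B
  generalize Submodule.span F (Set.range ![x, y, g x, g y]) = U at *
  have hx : x ∈ U := by have := (B 0).2; rwa [hB] at this
  have hy : y ∈ U := by have := (B 1).2; rwa [hB] at this
  have hgx : g x ∈ U := by have := (B 2).2; rwa [hB] at this
  have hgy : g y ∈ U := by have := (B 3).2; rwa [hB] at this
  have hUdim : finrank F U = 4 := by simp [finrank_eq_card_basis B]
  have hdim := Submodule.finrank_add_eq_of_isCompl hc
  have hUn := restrict_nondegenerate hb hc
  have hWn := restrict_nondegenerate hb (isCompl_orthogonal_orthogonal hb hn hc)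
  have hUW : ∀ u ∈ U, ∀ v ∈ b.orthogonal U, b u v = 0 := fun u hu v hv => hv u hu
  have hWU : ∀ v ∈ b.orthogonal U, ∀ u ∈ U, b v u = 0 := fun v hv u hu => hb.isRefl _ _ (hv u hu)
  generalize b.orthogonal U = W at *
  let h : End F W := W.projectionOnto U hc.symm ∘ₗ g ∘ₗ W.subtype
  -- `g v - h v` lies in `U` and is orthogonal to `gL`, hence lies in `gL`.
  have hh : ∀ v : W, ∃ α β : F, g v = h v + (α • g x + β • g y) := by
    intro v
    have hmem : g v - h v ∈ U := by
      have := Submodule.sub_projection_mem hc.symm (g v)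
      rwa [Submodule.projection_apply] at this
    obtain ⟨a₁, a₂, a₃, a₄, ha⟩ := hspan _ hmem
    have h1 : b (g x) (g v - h v) = 0 := by
      rw [map_sub, hg, hUW x hx v v.2, hUW _ hgx _ (h v).2, sub_zero]
    have h2 : b (g y) (g v - h v) = 0 := by
      rw [map_sub, hg, hUW y hy v v.2, hUW _ hgy _ (h v).2, sub_zero]
    have e1 : b (g x) x = -b x (g x) := (hb.neg_eq _ _).symm
    have e2 : b (g y) y = -b y (g y) := (hb.neg_eq _ _).symm
    have e3 : b (g x) y = -b x (g y) := by rw [hs, hb.neg_eq]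
    have e4 : b (g y) x = -b x (g y) := by rw [hb.neg_eq]
    rw [ha] at h1 h2
    simp only [map_add, map_smul, smul_eq_mul, e1, e2, e3, e4, hg x y, hg y x, hxy,
      hb.isRefl _ _ hxy, hb.self_eq_zero] at h1 h2
    obtain ⟨r1, r2⟩ := eq_zero_of_mul_sub_ne_zero (a := a₁) (c := a₂) hd
      (by linear_combination -h1) (by linear_combination -h2)
    refine ⟨a₃, a₄, ?_⟩
    rw [← sub_eq_iff_eq_add', ha, r1, r2]
    module
  clear_value h
  -- The error terms lie in `gL`, which is isotropic and orthogonal to `W`, so they do not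
  -- contribute.
  have hiso : IsIsom (b.restrict W) h := by
    intro v v'
    obtain ⟨α, β, e⟩ := hh v
    obtain ⟨α', β', e'⟩ := hh v'
    have := hg v v'
    rw [e, e'] at this
    simpa [hg x y, hg y x, hxy, hb.isRefl _ _ hxy, hb.self_eq_zero, hUW _ hgx _ (h v').2,
      hUW _ hgy _ (h v').2, hWU _ (h v).2 _ hgx, hWU _ (h v).2 _ hgy] using this
  obtain ⟨j, rfl⟩ := Nat.exists_eq_add_of_le (show 2 ≤ k by omega)
  obtain ⟨d, a, hdp, ha, rfl⟩ := (H W (by omega) hWn h hiso).exists_mul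
  obtain ⟨d', hd', -, hdd'⟩ := hdp.exists_inv
  obtain ⟨μ, hμ⟩ := ((Module.End.finite_hasEigenvalue a).union
    (Set.toFinite {0, 1, -1})).exists_notMem
  simp only [Set.mem_union, Set.mem_ofPred_eq, Set.mem_insert_iff, Set.mem_singleton_iff,
    not_or] at hμ
  obtain ⟨hμa, h0, h1, h1'⟩ := hμ
  have hμμ : μ * μ ≠ 1 := fun h => (mul_self_eq_one_iff.1 h).elim h1 h1'
  have haμ : ∀ v, a v = μ • v → v = 0 := fun v hv => by
    by_contra hne
    exact hμa (Module.End.hasEigenvalue_of_hasEigenvector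
      ⟨Module.End.mem_eigenspace_iff.2 hv, hne⟩)
  obtain ⟨c₀, hc₀, hc2, hc3⟩ := exists_quadratic_extension (restrict_isAlt hb U) hUn B
    (show b (B 0) (B 1) = 0 by simpa [hB] using hxy)
    (show b (B 2) (B 3) = 0 by simpa [hB, hg x y] using hxy)
    (show b (B 0) (B 3) = b (B 1) (B 2) by simpa [hB] using hs) h0 hμμ
  -- The bound `4 ≤ k` enters here: `c₀` costs two involutions and must fit into `j = k - 2`.
  have hcp := (hc₀.mono (show 2 ≤ j by omega)).directSum hc hUW hWU hd'
  have hcx : directSum hc c₀ d' (g x) = μ • x := by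
    have := directSum_left hc c₀ d' (B 2)
    rw [hc2] at this
    simpa [hB] using this
  have hcy : directSum hc c₀ d' (g y) = μ • y := by
    have := directSum_left hc c₀ d' (B 3)
    rw [hc3] at this
    simpa [hB] using this
  have hcW := directSum_right hc c₀ d'
  generalize directSum hc c₀ d' = c at *
  obtain ⟨c', hc', -, hcc'⟩ := hcp.exists_inv
  have hw : IsInvProd b 2 (c * g) := by
    refine isInvProd_two_of_scalar_on_isotropic hb hn (L := Submodule.span F {x, y}) (W := W)
      ?_ ?_ hWn (by omega) ?_ (hcp.isIsom.mul hg) h0 hμμ ?_ ha haμ ?_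
    · intro l hl l' hl'
      obtain ⟨p, q, rfl⟩ := Submodule.mem_span_pair.1 hl
      obtain ⟨p', q', rfl⟩ := Submodule.mem_span_pair.1 hl'
      simp [hxy, hb.isRefl _ _ hxy, hb.self_eq_zero]
    · intro l hl v hv
      obtain ⟨p, q, rfl⟩ := Submodule.mem_span_pair.1 hl
      simp [hUW x hx v hv, hUW y hy v hv]
    · intro z hz
      obtain ⟨u, v, rfl, -⟩ := Submodule.existsUnique_add_of_isCompl hc z
      obtain ⟨a₁, a₂, a₃, a₄, hu⟩ := hspan u u.2
      have h1 := hz x (Submodule.subset_span (by simp))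
      have h2 := hz y (Submodule.subset_span (by simp))
      rw [hu] at h1 h2
      simp only [map_add, map_smul, smul_eq_mul, hxy, hb.isRefl _ _ hxy, hb.self_eq_zero,
        hUW x hx v v.2, hUW y hy v v.2, ← hs] at h1 h2
      obtain ⟨r1, r2⟩ := eq_zero_of_mul_sub_ne_zero (a := a₃) (c := a₄) hd
        (by linear_combination h1) (by linear_combination h2)
      refine ⟨a₁ • x + a₂ • y, Submodule.mem_span_pair.2 ⟨_, _, rfl⟩, v, ?_⟩
      rw [hu, r1, r2]
      module
    · intro l hl
      obtain ⟨p, q, rfl⟩ := Submodule.mem_span_pair.1 hl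
      simp only [Module.End.mul_apply, map_add, map_smul, hcx, hcy]
      module
    · intro v
      obtain ⟨α, β, e⟩ := hh v
      refine Submodule.mem_span_pair.2 ⟨μ * α, μ * β, ?_⟩
      have e2 : d' (d (a v)) = a v := LinearMap.congr_fun hdd' (a v)
      rw [Module.End.mul_apply, e]
      simp only [map_add, map_smul, hcx, hcy, hcW, Module.End.mul_apply, e2]
      module
  have := hc'.mul hw
  rwa [← mul_assoc, hcc', one_mul] at this

/-! ### Rank estimates for skew endomorphisms -/

section Dimension

lemma finrank_span_pair_le (x y : V) : finrank F (Submodule.span F {x, y}) ≤ 2 := by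
  classical
  have := finrank_span_finset_le_card (R := F) ({x, y} : Finset V)
  simp only [Finset.coe_insert, Finset.coe_singleton] at this
  exact this.trans Finset.card_le_two

variable [FiniteDimensional F V]

lemma finrank_le_finrank_map_add (D : End F V) (W : Submodule F V) :
    finrank F W ≤ finrank F (W.map D) + finrank F (W ⊓ D.ker : Submodule F V) := by
  have h1 := LinearMap.finrank_range_add_finrank_ker (D.domRestrict W)
  have h2 : (D.domRestrict W).range = W.map D := LinearMap.range_domRestrict W D
  have h3 : finrank F (D.domRestrict W).ker ≤ finrank F (W ⊓ D.ker : Submodule F V) := by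
    rw [← Submodule.finrank_map_subtype_eq]
    refine Submodule.finrank_mono ?_
    rintro _ ⟨z, hz, rfl⟩
    exact ⟨z.2, hz⟩
  rw [h2] at h1
  omega

/-- Skewness gives one inclusion; dimensions agree by rank-nullity. -/
lemma orthogonal_ker_eq_range (hn : b.Nondegenerate) {D : End F V}
    (hD : ∀ x y, b (D x) y = -b x (D y)) : b.orthogonal D.ker = D.range := by
  symm
  refine Submodule.eq_of_le_of_finrank_eq ?_ ?_
  · rintro _ ⟨z, rfl⟩ u hu
    have := hD u z
    rw [LinearMap.mem_ker.1 hu] at this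
    simpa using this.symm
  · rw [LinearMap.BilinForm.finrank_orthogonal hn]
    have := LinearMap.finrank_range_add_finrank_ker D
    omega

/-- If the form `P (y, z) = b (y, D z)` coincides with the square of a linear form, up to a nonzero
scalar, on the orthogonal of `x` and `T x`, then its rank is small. -/
lemma finrank_range_le (hb : b.IsAlt) (hn : b.Nondegenerate) {D T : End F V}
    (hD : ∀ x y, b (D x) y = -b x (D y)) {x : V} (hx : b x (D x) ≠ 0)
    (h : ∀ y z, b x y = 0 → b (T x) y = 0 → b x z = 0 → b (T x) z = 0 →
      b x (D x) * b y (D z) = b x (D y) * b x (D z)) :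
    finrank F D.range ≤
      1 + 2 * finrank F (Submodule.span F {x, T x} ⊓ D.range : Submodule F V) := by
  set S := Submodule.span F {x, T x} with hS
  have hxS : x ∈ S := Submodule.subset_span (by simp)
  have hTS : T x ∈ S := Submodule.subset_span (by simp)
  set W := b.orthogonal (S ⊔ Submodule.span F {D x}) with hW
  -- For `y ∈ W`, `b (x, D y) = 0`, so the hypothesis makes `D y` orthogonal to `Sᗮ`. Rank-nullity
  -- for `D` on `W` then gives the bound.
  have hmap : W.map D ≤ S ⊓ D.range := by
    rintro _ ⟨y, hy, rfl⟩
    refine ⟨?_, y, rfl⟩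
    rw [← LinearMap.BilinForm.orthogonal_orthogonal hn hb.isRefl S]
    intro z hz
    have hy1 : b x y = 0 := hy x (Submodule.mem_sup_left hxS)
    have hy2 : b (T x) y = 0 := hy _ (Submodule.mem_sup_left hTS)
    have hy3 : b (D x) y = 0 := hy _ (Submodule.mem_sup_right (Submodule.mem_span_singleton_self _))
    have := h z y (hz x hxS) (hz _ hTS) hy1 hy2
    rw [hD, neg_eq_zero] at hy3
    rw [hy3, mul_zero] at this
    exact (mul_eq_zero.1 this).resolve_left hx
  have hker : W ⊓ D.ker ≤ b.orthogonal (S ⊔ D.range) := by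
    rintro y ⟨hy, hy'⟩ u hu
    obtain ⟨s, hs, _, ⟨z, rfl⟩, rfl⟩ := Submodule.mem_sup.1 hu
    change b (s + D z) y = 0
    have h1 : b s y = 0 := hy s (Submodule.mem_sup_left hs)
    rw [map_add, LinearMap.add_apply, hD, LinearMap.mem_ker.1 hy', map_zero, neg_zero, add_zero, h1]
  have d1 := finrank_le_finrank_map_add D W
  have d2 := Submodule.finrank_mono hmap
  have d3 := Submodule.finrank_mono hker
  have d4 := Submodule.finrank_sup_add_finrank_inf_eq S D.range
  have d5 := Submodule.finrank_add_le_finrank_add_finrank S (Submodule.span F {D x})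
  have d6 : finrank F (Submodule.span F {D x}) ≤ 1 :=
    (finrank_span_le_card {D x}).trans (by simp)
  have d7 := Submodule.finrank_le (S ⊔ D.range)
  have d8 := Submodule.finrank_le (S ⊔ Submodule.span F {D x})
  rw [LinearMap.BilinForm.finrank_orthogonal hn] at d3
  rw [hW, LinearMap.BilinForm.finrank_orthogonal hn, ← hW] at d1
  omega

end Dimension

/-! ### Vectors on which the quadratic form of `D` does not vanish -/

section Vectors

/-- A skew endomorphism `D` with `b (x, D x) = 0` for all `x` vanishes. -/
lemma eq_zero_of_apply_self (hb : b.IsAlt) (hn : b.Nondegenerate) (h2 : (2 : F) ≠ 0) {D : End F V}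
    (hD : ∀ x y, b (D x) y = -b x (D y)) (h : ∀ x, b x (D x) = 0) : D = 0 := by
  ext y
  refine eq_zero_of_forall hn fun x => ?_
  have h1 := h (x + y)
  have h3 : b y (D x) = b x (D y) := by rw [← hb.neg_eq, hD, neg_neg]
  simp only [map_add, LinearMap.add_apply, h, h3, zero_add, add_zero] at h1
  rw [hD, h3, neg_eq_zero]
  refine (mul_eq_zero.1 (?_ : 2 * b x (D y) = 0)).resolve_left h2
  linear_combination h1

/-- A nonzero quadratic form does not vanish outside of a proper subspace. -/
lemma exists_notMem_apply_self_ne_zero (h2 : (2 : F) ≠ 0) {D : End F V} {R : Submodule F V}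
    (hR : R ≠ ⊤) (h : ∃ x, b x (D x) ≠ 0) : ∃ x, x ∉ R ∧ b x (D x) ≠ 0 := by
  by_contra! hc
  obtain ⟨z, hz⟩ : ∃ z, z ∉ R := by
    by_contra! h
    exact hR (Submodule.eq_top_iff'.2 h)
  obtain ⟨x, hx⟩ := h
  have hxR : x ∈ R := by
    by_contra h
    exact hx (hc x h)
  have h1 := hc (z + x) fun h => hz ((Submodule.add_mem_iff_left R hxR).1 h)
  have h3 := hc (z - x) fun h => hz ((Submodule.sub_mem_iff_left R hxR).1 h)
  have h4 := hc z hz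
  simp only [map_add, map_sub, LinearMap.add_apply, LinearMap.sub_apply] at h1 h3
  refine hx ((mul_eq_zero.1 (?_ : 2 * b x (D x) = 0)).resolve_left h2)
  linear_combination h1 + h3 - 2 * h4

end Vectors

/-! ### Existence of the isotropic plane -/

section Plane

variable [FiniteDimensional F V]

/-- If `D = g - g⁻¹` has rank at least three, and at least four unless `D ^ 2 = 0`, then there is a
plane as required by `isInvProd_of_plane`. -/
lemma exists_plane (hb : b.IsAlt) (hn : b.Nondegenerate) (h2 : (2 : F) ≠ 0)
    (hV : 6 ≤ finrank F V) {g g' : End F V} (hg : IsIsom b g) (hgg' : g * g' = 1) (hg'g : g' * g = 1)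
    (hr : 3 ≤ finrank F (g - g').range)
    (hr' : finrank F (g - g').range = 3 → (g - g') * (g - g') = 0) :
    ∃ x y, b x y = 0 ∧ b x (g y) = b y (g x) ∧ b x (g x) * b y (g y) ≠ b x (g y) ^ 2 := by
  by_contra! hno
  have hadj : ∀ x y, b (g x) y = b x (g' y) := fun x y => by
    rw [← hg x (g' y)]; exact congrArg (b (g x)) (LinearMap.congr_fun hgg' y).symm
  have hadj' : ∀ x y, b (g' x) y = b x (g y) := fun x y => by
    rw [← hg (g' x) y]; exact congrArg (fun t => b t (g y)) (LinearMap.congr_fun hgg' x)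
  obtain ⟨D, hDdef⟩ : ∃ D, D = g - g' := ⟨_, rfl⟩
  obtain ⟨T, hTdef⟩ : ∃ T, T = g + g' := ⟨_, rfl⟩
  rw [← hDdef] at hr hr'
  have hD : ∀ x y, b (D x) y = -b x (D y) := fun x y => by
    simp [hDdef, hadj, hadj']
  have hT : ∀ x y, b (T x) y = b x (T y) := fun x y => by
    simp [hTdef, hadj, hadj', add_comm]
  have hsymm : ∀ x y, b y (D x) = b x (D y) := fun x y => by rw [← hb.neg_eq, hD, neg_neg]
  have hTD : T * D = D * T := by
    rw [hTdef, hDdef]; simp only [add_mul, mul_add, sub_mul, mul_sub, hgg', hg'g]; abel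
  have hTT : T * T = D * D + (4 : F) • 1 := by
    rw [hTdef, hDdef]; simp only [add_mul, mul_add, sub_mul, mul_sub, hgg', hg'g]
    module
  -- `b (T x) y = 0` says that `b (·, g ·)` is symmetric on the pair `x`, `y`; there `b (·, D ·)` is
  -- twice that form. The absence of a plane thus becomes a vanishing determinant, which `key`
  -- polarises.
  have hno' : ∀ x y, b x y = 0 → b (T x) y = 0 →
      b x (D x) * b y (D y) = b x (D y) ^ 2 := by
    intro x y h1 h3
    have e1 : ∀ x y, b x (g' y) = - b y (g x) := fun x y => by rw [← hadj, hb.neg_eq]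
    have h4 : b x (g y) = b y (g x) := by
      rw [hT, hTdef, LinearMap.add_apply, map_add, e1] at h3
      linear_combination h3
    have h5 := hno x y h1 h4
    simp only [hDdef, LinearMap.sub_apply, map_sub, e1, ← h4]
    linear_combination 4 * h5
  have key : ∀ x, b x (D x) ≠ 0 → finrank F D.range ≤
      1 + 2 * finrank F (Submodule.span F {x, T x} ⊓ D.range : Submodule F V) := by
    intro x hx
    refine finrank_range_le hb hn hD hx fun y z hy hy' hz hz' => ?_
    have h1 := hno' x y hy hy'
    have h3 := hno' x z hz hz'
    have h4 := hno' x (y + z) (by rw [map_add, hy, hz, add_zero])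
      (by rw [map_add, hy', hz', add_zero])
    simp only [map_add, LinearMap.add_apply, hsymm y z] at h4
    refine mul_left_cancel₀ h2 ?_
    linear_combination h4 - h1 - h3
  have hDne : D ≠ 0 := by
    intro h
    rw [h, LinearMap.range_zero, finrank_bot] at hr
    omega
  have hex : ∃ x, b x (D x) ≠ 0 := by
    by_contra! h
    exact hDne (eq_zero_of_apply_self hb hn h2 hD h)
  by_cases hDD : D * D = 0
  · have hDD' : ∀ x, D (D x) = 0 := LinearMap.congr_fun hDD
    have hTT' : ∀ x, T (T x) = (4 : F) • x := fun x => by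
      have := LinearMap.congr_fun hTT x
      rw [hDD, zero_add] at this
      exact this
    have hTD' : ∀ x, T (D x) = D (T x) := LinearMap.congr_fun hTD
    -- Since `T² = 4`, the vectors `T x ± 2 x` are eigenvectors of `T`, and the values of `b (z, D
    -- z)` at them add up to `16 b (x, D x)`. For such an eigenvector, `span {x, T x}` is a line
    -- meeting `D.range` trivially, which forces rank at most one.
    obtain ⟨x, ε, hx, hTx⟩ : ∃ x, ∃ ε : F, b x (D x) ≠ 0 ∧ T x = ε • x := by
      by_contra! h
      apply hDne
      refine eq_zero_of_apply_self hb hn h2 hD fun x => ?_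
      have t1 : T (T x + (2 : F) • x) = (2 : F) • (T x + (2 : F) • x) := by
        rw [map_add, hTT', map_smul]; module
      have t2 : T (T x - (2 : F) • x) = (-2 : F) • (T x - (2 : F) • x) := by
        rw [map_sub, hTT', map_smul]; module
      have s1 : b (T x + (2 : F) • x) (D (T x + (2 : F) • x)) = 0 := by
        by_contra hne
        exact h _ _ hne t1
      have s2 : b (T x - (2 : F) • x) (D (T x - (2 : F) • x)) = 0 := by
        by_contra hne
        exact h _ _ hne t2
      have s3 : b (T x) (D (T x)) = 4 * b x (D x) := by
        rw [hT, ← hTD', hTD', hTD', hTT']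
        simp
      simp only [map_add, map_sub, map_smul, LinearMap.add_apply, LinearMap.sub_apply,
        LinearMap.smul_apply, smul_eq_mul, s3] at s1 s2
      have h16 : (2 : F) ^ 4 ≠ 0 := pow_ne_zero _ h2
      refine (mul_eq_zero.1 (?_ : 2 ^ 4 * b x (D x) = 0)).resolve_left h16
      linear_combination s1 + s2
    have h1 := key x hx
    have h3 : (Submodule.span F {x, T x} ⊓ D.range : Submodule F V) = ⊥ := by
      rw [eq_bot_iff]
      rintro u ⟨hu, z, hz⟩
      obtain ⟨p, q, rfl⟩ := Submodule.mem_span_pair.1 hu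
      rw [hTx, smul_smul, ← add_smul] at hz ⊢
      have h5 : D ((p + q * ε) • x) = 0 := by rw [← hz, hDD']
      rw [map_smul] at h5
      have h6 : D x ≠ 0 := fun h => hx (by rw [h, map_zero])
      simp [(smul_eq_zero.1 h5).resolve_right h6]
    rw [h3, finrank_bot] at h1
    omega
  · have hr4 : finrank F D.range ≠ 3 := fun h => hDD (hr' h)
    -- The rank is at least four here. If `D` is onto, `key` gives `dim V ≤ 5`; otherwise `x` can be
    -- taken outside the range, the intersection is at most a line, and the rank is at most three.
    by_cases htop : D.range = ⊤
    · obtain ⟨x, hx⟩ := hex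
      have h1 := key x hx
      have h3 := finrank_span_pair_le (F := F) x (T x)
      have h4 : finrank F (Submodule.span F {x, T x} ⊓ D.range : Submodule F V) ≤
        finrank F (Submodule.span F {x, T x}) := Submodule.finrank_mono inf_le_left
      rw [htop, finrank_top] at h1
      rw [htop] at h4
      omega
    · obtain ⟨x, hxR, hx⟩ := exists_notMem_apply_self_ne_zero h2 htop hex
      have h1 := key x hx
      have h3 := finrank_span_pair_le (F := F) x (T x)
      have h4 : finrank F (Submodule.span F {x, T x} ⊓ D.range : Submodule F V) <
          finrank F (Submodule.span F {x, T x}) := by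
        refine Submodule.finrank_lt_finrank_of_lt (lt_of_le_of_ne inf_le_left fun h => hxR ?_)
        have : x ∈ Submodule.span F {x, T x} := Submodule.subset_span (by simp)
        rw [← h] at this
        exact this.2
      omega

end Plane

/-! ### Regular planes on which `g` is `±1`, and the dimension count -/

/-- `x`, `y` span a regular plane on which `g` acts as `ε = ±1`. -/
def IsEigenpair (b : LinearMap.BilinForm F V) (g : End F V) (ε : F) (x y : V) : Prop :=
  ε * ε = 1 ∧ g x = ε • x ∧ g y = ε • y ∧ b x y ≠ 0

/-- `g` acts as `±1` on each of two orthogonal regular planes. -/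
def HasEigenpairs (b : LinearMap.BilinForm F V) (g : End F V) : Prop :=
  ∃ ε x y ε' x' y', IsEigenpair b g ε x y ∧ IsEigenpair b g ε' x' y' ∧
    b x x' = 0 ∧ b x y' = 0 ∧ b y x' = 0 ∧ b y y' = 0

/-- The induction step for isometries acting as an involution on a regular subspace of dimension
four. -/
lemma isInvProd_of_hasEigenpairs [FiniteDimensional F V] (hb : b.IsAlt) (hn : b.Nondegenerate)
    {k : ℕ} (hk : 1 ≤ k)
    (H : ∀ W : Submodule F V, finrank F W + 4 = finrank F V → (b.restrict W).Nondegenerate →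
      ∀ h : End F W, IsIsom (b.restrict W) h → IsInvProd (b.restrict W) k h)
    {g : End F V} (hg : IsIsom b g) (h : HasEigenpairs b g) : IsInvProd b k g := by
  obtain ⟨ε, x, y, ε', x', y', ⟨hε, hgx, hgy, hxy⟩, ⟨hε', hgx', hgy', hxy'⟩, h1, h2, h3, h4⟩ := h
  have hgram : ∀ c : Fin 4 → F, (∀ j, ∑ i, c i * b (![x, y, x', y'] i) (![x, y, x', y'] j) = 0)
      → c = 0 := by
    intro c hc
    have c0 := hc 0
    have c1 := hc 1
    have c2 := hc 2
    have c3 := hc 3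
    have hyx : b y x ≠ 0 := fun h => hxy (hb.isRefl _ _ h)
    have hyx' : b y' x' ≠ 0 := fun h => hxy' (hb.isRefl _ _ h)
    simp [Fin.sum_univ_four, hb.self_eq_zero, h1, h2, h3, h4, hb.isRefl _ _ h1, hb.isRefl _ _ h2,
      hb.isRefl _ _ h3, hb.isRefl _ _ h4, hxy, hyx, hxy', hyx'] at c0 c1 c2 c3
    ext i
    fin_cases i <;> simp [c0, c1, c2, c3]
  have hc := isCompl_orthogonal_of_gram hb hgram
  have hU := finrank_span_eq_card (linearIndependent_of_gram hgram)
  rw [Fintype.card_fin] at hU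
  have gU : ∀ u ∈ Submodule.span F (Set.range ![x, y, x', y']),
      g u ∈ Submodule.span F (Set.range ![x, y, x', y']) ∧ g (g u) = u := by
    intro u hu
    obtain ⟨c, rfl⟩ := (Submodule.mem_span_range_iff_exists_fun F).1 hu
    constructor
    · refine (Submodule.mem_span_range_iff_exists_fun F).2
        ⟨![c 0 * ε, c 1 * ε, c 2 * ε', c 3 * ε'], ?_⟩
      simp [Fin.sum_univ_four, hgx, hgy, hgx', hgy', smul_smul]
    · simp [Fin.sum_univ_four, hgx, hgy, hgx', hgy', smul_smul, mul_assoc, hε, hε']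
  generalize Submodule.span F (Set.range ![x, y, x', y']) = U at *
  have hdim := Submodule.finrank_add_eq_of_isCompl hc
  have gW : ∀ z ∈ b.orthogonal U, g z ∈ b.orthogonal U := by
    intro z hz u hu
    change b u (g z) = 0
    rw [← (gU u hu).2, hg]
    exact hz _ (gU u hu).1
  refine isInvProd_of_isCompl hc (fun u hu v hv => hv u hu) (fun v hv u hu => hb.isRefl _ _ (hv u hu))
    (fun u hu => (gU u hu).1) gW ?_ ?_
  · refine IsInvProd.mono hk (IsInvol.isInvProd (b := b.restrict U) ⟨?_, fun u v => hg u v⟩)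
    ext u
    exact (gU u u.2).2
  · exact H _ (by omega) (restrict_nondegenerate hb (isCompl_orthogonal_orthogonal hb hn hc)) _
      (fun u v => hg u v)

/-- If `g` has no eigenpair in a `g`-stable subspace `K` with `g ^ 2 = 1` on `K`, then `K` is
isotropic. -/
lemma isotropic_of_not_isEigenpair (h2 : (2 : F) ≠ 0) {g : End F V} (hg : IsIsom b g)
    {K : Submodule F V} (hK : ∀ u ∈ K, g u ∈ K ∧ g (g u) = u)
    (h : ∀ ε, ∀ u ∈ K, ∀ v ∈ K, ¬ IsEigenpair b g ε u v) : ∀ u ∈ K, ∀ v ∈ K, b u v = 0 := by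
  intro u hu v hv
  obtain ⟨gu, ggu⟩ := hK u hu
  obtain ⟨gv, ggv⟩ := hK v hv
  -- `u ± g u` and `v ± g v` are eigenvectors for `±1`, and the two pairings add up to `4 b (u, v)`.
  have s1 : b (u + g u) (v + g v) = 0 := by
    by_contra hne
    exact h 1 _ (add_mem hu gu) _ (add_mem hv gv)
      ⟨by ring, by rw [map_add, ggu]; module, by rw [map_add, ggv]; module, hne⟩
  have s2 : b (u - g u) (v - g v) = 0 := by
    by_contra hne
    exact h (-1) _ (sub_mem hu gu) _ (sub_mem hv gv)
      ⟨by ring, by rw [map_sub, ggu]; module, by rw [map_sub, ggv]; module, hne⟩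
  have s3 := hg u v
  simp only [map_add, map_sub, LinearMap.add_apply, LinearMap.sub_apply, s3] at s1 s2
  refine (mul_eq_zero.1 (?_ : 2 ^ 2 * b u v = 0)).resolve_left (pow_ne_zero _ h2)
  linear_combination s1 + s2

/-- Either `K` is isotropic, or it contains a regular plane `U` on which `g` is `±1`. In the latter
case `K ∩ Uᗮ` carries no further eigenpair, so it is isotropic and lies in the radical of `K`, with
codimension at most two. -/
lemma finrank_le_of_not_hasEigenpairs [FiniteDimensional F V] (hb : b.IsAlt)
    (h2 : (2 : F) ≠ 0) {g : End F V} (hg : IsIsom b g) {K : Submodule F V}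
    (hK : ∀ u, u ∈ K ↔ g (g u) = u) (h : ¬ HasEigenpairs b g) :
    finrank F K ≤ 2 + finrank F (K ⊓ b.orthogonal K : Submodule F V) := by
  have hgK : ∀ u ∈ K, g u ∈ K ∧ g (g u) = u := fun u hu =>
    ⟨(hK _).2 (by rw [(hK u).1 hu]), (hK u).1 hu⟩
  by_cases hex : ∃ ε x y, IsEigenpair b g ε x y
  · obtain ⟨ε, x, y, hp⟩ := hex
    obtain ⟨hε, hgx, hgy, hxy⟩ := id hp
    have hgram := gram_pair hb hxy
    have hc := isCompl_orthogonal_of_gram hb hgram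
    have hU := finrank_span_eq_card (linearIndependent_of_gram hgram)
    rw [Fintype.card_fin] at hU
    have hxU : x ∈ Submodule.span F (Set.range ![x, y]) := Submodule.subset_span ⟨0, rfl⟩
    have hyU : y ∈ Submodule.span F (Set.range ![x, y]) := Submodule.subset_span ⟨1, rfl⟩
    have hgU : ∀ u ∈ Submodule.span F (Set.range ![x, y]), g u = ε • u := by
      intro u hu
      obtain ⟨c, rfl⟩ := (Submodule.mem_span_range_iff_exists_fun F).1 hu
      simp [hgx, hgy, smul_comm ε]
    generalize Submodule.span F (Set.range ![x, y]) = U at *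
    have hUK : U ≤ K := fun u hu => (hK u).2 (by
      rw [hgU u hu, map_smul, hgU u hu, smul_smul, hε, one_smul])
    have hdim := Submodule.finrank_add_eq_of_isCompl hc
    have hiso : ∀ u ∈ K ⊓ b.orthogonal U, ∀ v ∈ K ⊓ b.orthogonal U, b u v = 0 := by
      refine isotropic_of_not_isEigenpair h2 hg (fun u hu => ⟨⟨(hgK u hu.1).1, fun z hz => ?_⟩,
        (hgK u hu.1).2⟩) fun ε' u hu v hv hp' => h ⟨ε, x, y, ε', u, v, hp, hp', hu.2 x hxU,
          hv.2 x hxU, hu.2 y hyU, hv.2 y hyU⟩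
      change b z (g u) = 0
      rw [← (hgK z (hUK hz)).2, hg, hgU z hz, map_smul, LinearMap.smul_apply,
        show b z u = 0 from hu.2 z hz, smul_zero]
    have hle : K ⊓ b.orthogonal U ≤ K ⊓ b.orthogonal K := by
      refine fun v hv => ⟨hv.1, fun w hw => ?_⟩
      obtain ⟨u, u', rfl, -⟩ := Submodule.existsUnique_add_of_isCompl hc w
      have hu' : (u' : V) ∈ K := (Submodule.add_mem_iff_right K (hUK u.2)).1 hw
      change b (u + u') v = 0
      rw [map_add, LinearMap.add_apply, hiso _ ⟨hu', u'.2⟩ v hv, add_zero]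
      exact hv.2 u u.2
    have d1 := Submodule.finrank_mono hle
    have d2 := Submodule.finrank_sup_add_finrank_inf_eq K (b.orthogonal U)
    have d3 := Submodule.finrank_le (K ⊔ b.orthogonal U)
    omega
  · have hiso := isotropic_of_not_isEigenpair h2 hg hgK
      fun ε u _ v _ hp => hex ⟨ε, u, v, hp⟩
    have hle : K ≤ K ⊓ b.orthogonal K := fun v hv => ⟨hv, fun u hu => hiso u hu v hv⟩
    have := Submodule.finrank_mono hle
    omega

/-- The induction step: enlarging the dimension by four does not require more involutions. -/
lemma isInvProd_of_finrank_sub_four [Infinite F] [FiniteDimensional F V] (hb : b.IsAlt)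
    (hn : b.Nondegenerate) (h2 : (2 : F) ≠ 0) (hV : 8 ≤ finrank F V) {k : ℕ} (hk : 4 ≤ k)
    (H : ∀ W : Submodule F V, finrank F W + 4 = finrank F V → (b.restrict W).Nondegenerate →
      ∀ h : End F W, IsIsom (b.restrict W) h → IsInvProd (b.restrict W) k h)
    {g : End F V} (hg : IsIsom b g) : IsInvProd b k g := by
  by_cases hp : HasEigenpairs b g
  · exact isInvProd_of_hasEigenpairs hb hn (by omega) H hg hp
  have hinj : Function.Injective g := by
    rw [injective_iff_map_eq_zero]
    exact fun x hx => eq_zero_of_forall hn fun y => by rw [← hg, hx, map_zero, LinearMap.zero_apply]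
  obtain ⟨g', hgg', hg'g⟩ : ∃ g' : End F V, g * g' = 1 ∧ g' * g = 1 :=
    ⟨(LinearEquiv.ofInjectiveEndo g hinj).symm, LinearEquiv.ofInjectiveEndo_right_inv g hinj,
      LinearEquiv.ofInjectiveEndo_left_inv g hinj⟩
  have e1 : ∀ x, g (g' x) = x := LinearMap.congr_fun hgg'
  have e2 : ∀ x, g' (g x) = x := LinearMap.congr_fun hg'g
  have hD : ∀ x y, b ((g - g') x) y = -b x ((g - g') y) := fun x y => by
    have h1 := hg x (g' y)
    have h2 := hg (g' x) y
    rw [e1] at h1 h2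
    simp only [LinearMap.sub_apply, map_sub]
    linear_combination h1 + h2
  have hK : ∀ u, u ∈ (g - g').ker ↔ g (g u) = u := fun u => by
    rw [LinearMap.mem_ker, LinearMap.sub_apply, sub_eq_zero]
    refine ⟨fun h => by rw [h, e1], fun h => ?_⟩
    rw [← e2 (g u), h]
  have d1 := finrank_le_of_not_hasEigenpairs hb h2 hg hK hp
  rw [orthogonal_ker_eq_range hn hD] at d1
  have d2 := LinearMap.finrank_range_add_finrank_ker (g - g')
  have d3 : finrank F ((g - g').ker ⊓ (g - g').range : Submodule F V) ≤ finrank F (g - g').range :=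
    Submodule.finrank_mono inf_le_right
  -- The kernel has dimension at most `2` plus the rank, and the two sum to at least `8`, so the
  -- rank is at least `3`. Rank `3` forces the range into the kernel, that is, `(g - g')² = 0`.
  obtain ⟨x, y, hxy, hs, hd⟩ := exists_plane hb hn h2 (by omega) hg hgg' hg'g (by omega) fun hr => by
    have h1 : ((g - g').ker ⊓ (g - g').range : Submodule F V) = (g - g').range :=
      Submodule.eq_of_le_of_finrank_le inf_le_right (by omega)
    ext z
    have : (g - g') z ∈ (g - g').ker := (inf_eq_right.1 h1) ⟨z, rfl⟩
    exact LinearMap.mem_ker.1 this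
  exact isInvProd_of_plane hb hn hk H hg hxy hs hd

end SymplecticInvolutions

/-! ### Conclusion for the symplectic groups -/

open SymplecticInvolutions Matrix

lemma four_le_of_forall_isReflectional {F : Type*} [Field F] (h2 : (2 : F) ≠ 0) {r k : ℕ}
    (hr : 1 ≤ r) (h : ∀ g : symplecticGroup (Fin r) F, IsReflectional k g) : 4 ≤ k := by
  by_contra! hk
  obtain ⟨b, hb, hn, -⟩ := exists_standard F r
  have : Nonempty (Fin r ⊕ Fin r) := ⟨Sum.inl ⟨0, hr⟩⟩
  obtain ⟨v, hv⟩ := exists_ne (0 : Fin r ⊕ Fin r → F)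
  refine not_isInvProd_three_transvection hb hn h2 hv (IsInvProd.mono (by omega : k ≤ 3) ?_)
  exact isInvProd_of_isReflectional h hb hn (by simp; ring) (isIsom_transvection hb v)

/-- Every `k` admissible for `r` is admissible for `r + 2`; if there is none, the right side is `⊤`.
The bound `2 ≤ r` puts the larger space in dimension at least `8`. -/
lemma ellDouble_add_two_le {F : Type*} [Field F] [Infinite F] (h2 : (2 : F) ≠ 0) {r : ℕ}
    (hr : 2 ≤ r) : ellDouble F (r + 2) ≤ ellDouble F r := by
  refine le_iInf₂ fun k hk => iInf₂_le k fun g => ?_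
  obtain ⟨b, hb, hn, hB⟩ := exists_standard F (r + 2)
  refine isReflectional_of_isInvProd hB g ?_
  have hV : Module.finrank F (Fin (r + 2) ⊕ Fin (r + 2) → F) = 2 * r + 4 := by simp; ring
  refine isInvProd_of_finrank_sub_four hb hn h2 (by omega)
    (four_le_of_forall_isReflectional h2 (by omega) hk) (fun W hW hWn h hh =>
      isInvProd_of_isReflectional hk (restrict_isAlt hb W) hWn (by omega) hh) ?_
  rw [isIsom_iff_mem_symplecticGroup hB, LinearMap.toMatrix_toLin]
  exact g.2

theorem mainTheorem2 (F : Type*) [Field F] [Infinite F] (hF : ringChar F ≠ 2) :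
    AntitoneOn (fun n : ℕ => ellDouble F (2 * n + 1)) (Set.Ici 1) ∧
      AntitoneOn (fun n : ℕ => ellDouble F (2 * n)) (Set.Ici 1) := by
  have h2 : (2 : F) ≠ 0 := Ring.two_ne_zero hF
  constructor
  · exact antitoneOn_of_succ_le Set.ordConnected_Ici fun n _ hn _ =>
      ellDouble_add_two_le h2 (r := 2 * n + 1) (by have : 1 ≤ n := hn; omega)
  · exact antitoneOn_of_succ_le Set.ordConnected_Ici fun n _ hn _ =>
      ellDouble_add_two_le h2 (r := 2 * n) (by have : 1 ≤ n := hn; omega)
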